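/- Algebras here have type $(2,2,1,0,0)$ with operations $\vee,\wedge,{}',0,1$. For an integer $n\ge 3$ let $\mathbf M_n'$ be the bounded lattice $\{0,1,a_0,\dots,a_{n-1}\}$ of length $2$, in which $a_0,\dots,a_{n-1}$ are pairwise incomparable elements strictly between $0$ and $1$, equipped with the unary operation $0'=1$, $1'=0$, $a_i'=a_{i+1}$ (indices modulo $n$). Let $\mathsf V(\mathbf M_n')$ be the variety generated by $\mathbf M_n'$, and let $\mathbf 2$ be the two-element Boolean algebra. Theorem. For all integers $k\ge 1$ and $n\ge 3$, the number $$q=\frac{(n+2)^k-2^k}{n}$$ is a non-negative integer, and the free algebra on $k$ free generators in $\mathsf V(\mathbf M_n')$ exists and is isomorphic to $$(\mathbf M_n')^{q}\times\mathbf 2^{2^k}.$$ In particular, the free algebra on one free generator in $\mathsf V(\mathbf M_n')$ is isomorphic to $\mathbf M_n'\times\mathbf 2^2$. -/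

import Mathlib

open scoped FirstOrder

universe u v w

/-! ## Algebras of type `(2,2,1,0,0)` -/

/-- The operation symbols `∨, ∧, ', 0, 1`, indexed by their arities. -/
inductive LCFunc : ℕ → Type
  | sup : LCFunc 2
  | inf : LCFunc 2
  | compl : LCFunc 1
  | zero : LCFunc 0
  | one : LCFunc 0

/-- The signature of lattices with complementation: type `(2,2,1,0,0)`, no relation symbols.
An algebra of this type is a type with an `LCLang.Structure`; its homomorphisms and isomorphisms
are `A →[LCLang] B` and `A ≃[LCLang] B`, its subalgebras are `LCLang.Substructure A`. -/
abbrev LCLang : FirstOrder.Language where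
  Functions := LCFunc
  Relations := fun _ => Empty

/-- The algebra `(L, ∨, ∧, ', 0, 1)` of a bounded lattice with a unary operation. -/
@[reducible]
def latticeAlgebra (L : Type u) [Lattice L] [BoundedOrder L] [Compl L] : LCLang.Structure L where
  funMap := fun f => match f with
    | .sup => fun x => x 0 ⊔ x 1
    | .inf => fun x => x 0 ⊓ x 1
    | .compl => fun x => (x 0)ᶜ
    | .zero => fun _ => ⊥
    | .one => fun _ => ⊤
  RelMap := fun r => nomatch r

/-- Direct product of a family of algebras; operations are componentwise. -/
instance piAlgebra {I : Type u} (B : I → Type v) [∀ i, LCLang.Structure (B i)] :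
    LCLang.Structure (∀ i, B i) where
  funMap := fun f x i => FirstOrder.Language.Structure.funMap f (fun j => x j i)
  RelMap := fun r => nomatch r

/-- Direct product of two algebras; operations are componentwise. -/
instance prodAlgebra (A : Type u) (B : Type v) [LCLang.Structure A] [LCLang.Structure B] :
    LCLang.Structure (A × B) where
  funMap := fun f x => (FirstOrder.Language.Structure.funMap f (fun j => (x j).1),
    FirstOrder.Language.Structure.funMap f (fun j => (x j).2))
  RelMap := fun r => nomatch r

/-! ## Varieties and free algebras -/

/-- `InVariety M B`: the algebra `B` belongs to the variety generated by `M`, the smallest class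
of algebras (of a given universe) that contains the isomorphic copies of `M` and is closed under
homomorphic images, subalgebras and direct products of arbitrary families. -/
inductive InVariety (M : Type w) [LCLang.Structure M] :
    (B : Type u) → [LCLang.Structure B] → Prop
  | base (B : Type u) [LCLang.Structure B] (e : M ≃[LCLang] B) : InVariety M B
  | hom (B C : Type u) [LCLang.Structure B] [LCLang.Structure C] (f : B →[LCLang] C)
      (hf : Function.Surjective f) (hB : InVariety M B) : InVariety M C
  | sub (B : Type u) [LCLang.Structure B] (S : LCLang.Substructure B) (hB : InVariety M B) :
      InVariety M S
  | prod (I : Type u) (B : I → Type u) [∀ i, LCLang.Structure (B i)]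
      (hB : ∀ i, InVariety M (B i)) : InVariety M (∀ i, B i)

/-- `F` is a free algebra in the variety generated by `M`, with free generators `x j`, `j : J`:
it belongs to the variety, and every map from the generators to a member `A` of the variety
extends to exactly one homomorphism `F → A`. -/
def IsFreeInVariety (M : Type w) [LCLang.Structure M] {J : Type v} (F : Type u)
    [LCLang.Structure F] (x : J → F) : Prop :=
  InVariety.{u} M F ∧
    ∀ (A : Type u) [LCLang.Structure A], InVariety.{u} M A →
      ∀ a : J → A, ∃! φ : F →[LCLang] A, ∀ j, φ (x j) = a j

/-! ## The lattice `M_n` and its cyclic complementation -/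

/-- The underlying set `{0, 1, a_0, …, a_{n-1}}` of `M_n`, with indices modulo `n`. -/
inductive MPrime (n : ℕ) : Type
  | zero : MPrime n
  | one : MPrime n
  | atom (i : ZMod n) : MPrime n
  deriving DecidableEq

namespace MPrime

variable {n : ℕ}

/-- `0` is the least and `1` the greatest element, the `a_i` are pairwise incomparable. -/
instance : PartialOrder (MPrime n) where
  le x y := x = zero ∨ y = one ∨ x = y
  le_refl x := Or.inr (Or.inr rfl)
  le_trans x y z := by
    rintro (rfl | rfl | rfl) (h | rfl | rfl) <;> simp_all
  le_antisymm x y := by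
    rintro (rfl | rfl | rfl) (h | h | h) <;> simp_all

theorem le_def (x y : MPrime n) : x ≤ y ↔ x = zero ∨ y = one ∨ x = y := Iff.rfl

instance : Lattice (MPrime n) where
  sup x y := if x = zero then y else if y = zero then x else if x = y then x else one
  inf x y := if x = one then y else if y = one then x else if x = y then x else zero
  le_sup_left x y := by simp only [le_def]; split_ifs <;> simp_all
  le_sup_right x y := by simp only [le_def]; split_ifs <;> simp_all
  sup_le x y z := by simp only [le_def]; split_ifs <;> grind
  inf_le_left x y := by simp only [le_def]; split_ifs <;> simp_all
  inf_le_right x y := by simp only [le_def]; split_ifs <;> simp_all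
  le_inf x y z := by simp only [le_def]; split_ifs <;> grind

instance : BoundedOrder (MPrime n) where
  top := one
  le_top _ := Or.inr (Or.inl rfl)
  bot := zero
  bot_le _ := Or.inl rfl

/-- `0' = 1`, `1' = 0` and `a_i' = a_{i+1}`. -/
instance : Compl (MPrime n) where
  compl
    | zero => one
    | one => zero
    | atom i => atom (i + 1)

/-- The algebra `M_n'`. -/
instance : LCLang.Structure (MPrime n) := latticeAlgebra (MPrime n)

end MPrime

/-- The two-element Boolean algebra `2`. -/
noncomputable instance boolAlgebra : LCLang.Structure Bool := latticeAlgebra Bool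

open FirstOrder Language

/-! The free algebra on `J` is the algebra of `J`-ary term functions of `M_n'`, inside the power of
`M_n'` indexed by `J → MPrime n`. These are exactly the functions commuting with the rotations of
the atoms (`termFunctions_eq_equivariant`). Since `n ≥ 3`, `x ∨ x''` and `x ∧ x''` test for `x ≠ 0`
and `x = 1`. Such tests give characteristic functions of orbits of tuples, from which every
equivariant function is assembled.

An equivariant function is determined by its values on orbit representatives. A tuple containing an
atom has a free orbit of size `n`, so its value is arbitrary and each of these `q` orbits
contributes a factor `M_n'`. A 0-1-tuple is fixed by the rotations, so its value is 0 or 1 and each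
of these `2^k` tuples contributes a factor `2` (`restrictHom_bijective`). -/

instance LCLang.isAlgebraic : LCLang.IsAlgebraic := fun _ => inferInstanceAs (IsEmpty Empty)

/-- A bijective homomorphism of algebras is an isomorphism. -/
noncomputable def LCLang.equivOfBijective {A : Type u} {B : Type v} [LCLang.Structure A]
    [LCLang.Structure B] (f : A →[LCLang] B) (hf : Function.Bijective f) : A ≃[LCLang] B where
  toEquiv := Equiv.ofBijective f hf
  map_fun' := f.map_fun'
  map_rel' := fun r => nomatch r

/-- Evaluation at a coordinate is a homomorphism on a direct product. -/
def piEvalHom {I : Type u} (B : I → Type v) [∀ i, LCLang.Structure (B i)] (i : I) :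
    (∀ i, B i) →[LCLang] B i where
  toFun h := h i
  map_fun' _ _ := rfl
  map_rel' := fun r => nomatch r

/-- The homomorphism into a direct product with prescribed coordinates. -/
def piLiftHom {I : Type u} {A : Type w} [LCLang.Structure A] (B : I → Type v)
    [∀ i, LCLang.Structure (B i)] (φ : ∀ i, A →[LCLang] B i) : A →[LCLang] (∀ i, B i) where
  toFun a i := φ i a
  map_fun' f x := funext fun i => (φ i).map_fun f x
  map_rel' := fun r => nomatch r

/-! ### Membership in a generated variety and extension of maps. -/

namespace InVariety

variable {M : Type w} [LCLang.Structure M]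

theorem of_equiv {A B : Type u} [LCLang.Structure A] [LCLang.Structure B] (e : A ≃[LCLang] B)
    (hA : InVariety M A) : InVariety M B :=
  .hom A B e.toHom e.surjective hA

theorem of_injective {A B : Type u} [LCLang.Structure A] [LCLang.Structure B]
    (f : A →[LCLang] B) (hf : Function.Injective f) (hB : InVariety M B) : InVariety M A :=
  of_equiv (Embedding.ofInjective hf).equivRange.symm (.sub B _ hB)

/-- An algebra whose homomorphisms to `M` separate points belongs to the variety of `M`. -/
theorem of_separating {A : Type u} [LCLang.Structure A] {I : Type v} (e : I → A →[LCLang] M)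
    (he : ∀ a b, (∀ i, e i a = e i b) → a = b) [Small.{u} I] [Small.{u} M] : InVariety M A := by
  -- `M` may live in another universe than the members of the variety, so a copy of it in the right
  -- universe is used.
  let : LCLang.Structure (Shrink.{u} M) := Equiv.inducedStructure (equivShrink M)
  let s : M ≃[LCLang] Shrink.{u} M := Equiv.inducedStructureEquiv (equivShrink M)
  refine of_injective (piLiftHom (fun _ : Shrink.{u} I => Shrink.{u} M)
    fun i => s.toHom.comp (e ((equivShrink I).symm i))) (fun a b hab => he a b fun i => ?_)
    (.prod _ _ fun _ => .base _ s)
  have h : s (e ((equivShrink I).symm (equivShrink I i)) a) =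
      s (e ((equivShrink I).symm (equivShrink I i)) b) := congrFun hab (equivShrink I i)
  simpa using s.injective h

/-- If `F` is generated by `x` and every map from the generators to `M` extends to a homomorphism,
then so does every map from the generators to a member of the variety of `M`. -/
theorem exists_hom_extending {F : Type v} [LCLang.Structure F] {J : Type*} {x : J → F}
    (hx : Substructure.closure LCLang (Set.range x) = ⊤)
    (hM : ∀ a : J → M, ∃ φ : F →[LCLang] M, ∀ j, φ (x j) = a j) {A : Type u}
    [LCLang.Structure A] (hA : InVariety M A) (a : J → A) :
    ∃ φ : F →[LCLang] A, ∀ j, φ (x j) = a j := by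
  induction hA with
  | base B e =>
    obtain ⟨φ, hφ⟩ := hM fun j => e.symm (a j)
    exact ⟨e.toHom.comp φ, fun j => by simp [hφ]⟩
  | hom B C f hf _ ih =>
    choose b hb using fun j => hf (a j)
    obtain ⟨φ, hφ⟩ := ih b
    exact ⟨f.comp φ, fun j => by simp [hφ, hb]⟩
  | sub B S _ ih =>
    obtain ⟨φ, hφ⟩ := ih fun j => (a j : B)
    have hS : ⊤ ≤ S.comap φ := by
      rw [← hx, Substructure.closure_le]
      rintro _ ⟨j, rfl⟩
      simp [hφ]
    exact ⟨φ.codRestrict S fun c => hS (Substructure.mem_top c), fun j => Subtype.ext (hφ j)⟩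
  | prod I B _ ih =>
    choose φ hφ using fun i => ih i fun j => a j i
    exact ⟨piLiftHom B φ, fun j => funext fun i => hφ i j⟩

end InVariety

/-! ### Recognition and uniqueness of free algebras. -/

section Free

variable {M : Type w} [LCLang.Structure M] {J : Type v}

theorem isFreeInVariety_of_extending {F : Type u} [LCLang.Structure F] {x : J → F}
    (hF : InVariety M F) (hx : Substructure.closure LCLang (Set.range x) = ⊤)
    (hM : ∀ a : J → M, ∃ φ : F →[LCLang] M, ∀ j, φ (x j) = a j) : IsFreeInVariety M F x := by
  refine ⟨hF, fun A _ hA a => ?_⟩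
  obtain ⟨φ, hφ⟩ := hA.exists_hom_extending hx hM a
  refine ⟨φ, hφ, fun ψ hψ => Hom.eq_of_eqOn_dense hx ?_⟩
  rintro _ ⟨j, rfl⟩
  rw [hψ, hφ]

theorem IsFreeInVariety.nonempty_equiv {F G : Type u} [LCLang.Structure F] [LCLang.Structure G]
    {x : J → F} {y : J → G} (hF : IsFreeInVariety M F x) (hG : IsFreeInVariety M G y) :
    Nonempty (F ≃[LCLang] G) := by
  obtain ⟨φ, hφ, -⟩ := hF.2 G hG.1 y
  obtain ⟨ψ, hψ, -⟩ := hG.2 F hF.1 x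
  have h₁ : ψ.comp φ = Hom.id LCLang F :=
    (hF.2 F hF.1 x).unique (fun j => by simp [hφ, hψ]) (fun j => rfl)
  have h₂ : φ.comp ψ = Hom.id LCLang G :=
    (hG.2 G hG.1 y).unique (fun j => by simp [hφ, hψ]) (fun j => rfl)
  exact ⟨LCLang.equivOfBijective φ
    ⟨Function.LeftInverse.injective (g := ψ) fun a => DFunLike.congr_fun h₁ a,
      Function.RightInverse.surjective (g := ψ) fun b => DFunLike.congr_fun h₂ b⟩⟩

/-- An algebra generated by `x`, in which every map from the generators to `M` extends and whose
points are separated by homomorphisms to `M`, is isomorphic to every free algebra. -/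
theorem exists_isFreeInVariety_equiv {E : Type w} [LCLang.Structure E] [Small.{u} E]
    [Small.{u} (J → M)] [Small.{u} M] {x : J → E}
    (hx : Substructure.closure LCLang (Set.range x) = ⊤) (e : (J → M) → E →[LCLang] M)
    (hex : ∀ a j, e a (x j) = a j) (he : ∀ a b, (∀ i, e i a = e i b) → a = b) :
    ∃ (F : Type u) (_ : LCLang.Structure F) (y : J → F), IsFreeInVariety M F y ∧
      Nonempty (F ≃[LCLang] E) := by
  let : LCLang.Structure (Shrink.{u} E) := Equiv.inducedStructure (equivShrink E)
  let s : E ≃[LCLang] Shrink.{u} E := Equiv.inducedStructureEquiv (equivShrink E)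
  refine ⟨Shrink.{u} E, inferInstance, s ∘ x,
    isFreeInVariety_of_extending (.of_separating (fun a => (e a).comp s.symm.toHom) ?_) ?_ ?_,
    ⟨s.symm⟩⟩
  · intro a b h
    exact s.symm.injective (he _ _ h)
  · have := Substructure.closure_image s.toHom (s := Set.range x)
    rw [hx, ← Hom.range_eq_map, Equiv.toHom_range, ← Set.range_comp] at this
    exact this
  · exact fun a => ⟨(e a).comp s.symm.toHom, fun j => by simp [hex]⟩

end Free

/-! ### Rotations and unary tests on `M_n'`. -/

namespace MPrime

variable {n : ℕ}

theorem sup_def (x y : MPrime n) :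
    x ⊔ y = if x = zero then y else if y = zero then x else if x = y then x else one := rfl

theorem inf_def (x y : MPrime n) :
    x ⊓ y = if x = one then y else if y = one then x else if x = y then x else zero := rfl

theorem bot_def : (⊥ : MPrime n) = zero := rfl

theorem top_def : (⊤ : MPrime n) = one := rfl

@[simp] theorem compl_zero : (zero : MPrime n)ᶜ = one := rfl

@[simp] theorem compl_one : (one : MPrime n)ᶜ = zero := rfl

@[simp] theorem compl_atom (i : ZMod n) : (atom i)ᶜ = atom (i + 1) := rfl

/-- The automorphisms of `M_n'` that rotate the atoms. -/
instance : AddAction (ZMod n) (MPrime n) where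
  vadd c
    | zero => zero
    | one => one
    | atom i => atom (c + i)
  zero_vadd x := by
    cases x
    · rfl
    · rfl
    · exact congrArg atom (zero_add _)
  add_vadd c d x := by
    cases x
    · rfl
    · rfl
    · exact congrArg atom (add_assoc _ _ _)

@[simp] theorem vadd_zero' (c : ZMod n) : c +ᵥ (zero : MPrime n) = zero := rfl

@[simp] theorem vadd_one (c : ZMod n) : c +ᵥ (one : MPrime n) = one := rfl

@[simp] theorem vadd_atom (c i : ZMod n) : c +ᵥ (atom i : MPrime n) = atom (c + i) := rfl

theorem vadd_sup (c : ZMod n) (x y : MPrime n) : c +ᵥ (x ⊔ y) = (c +ᵥ x) ⊔ (c +ᵥ y) := by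
  cases x <;> cases y <;> simp [sup_def]

theorem vadd_inf (c : ZMod n) (x y : MPrime n) : c +ᵥ (x ⊓ y) = (c +ᵥ x) ⊓ (c +ᵥ y) := by
  cases x <;> cases y <;> simp [inf_def]

theorem vadd_compl (c : ZMod n) (x : MPrime n) : c +ᵥ xᶜ = (c +ᵥ x)ᶜ := by
  cases x <;> simp [add_assoc]

theorem vadd_funMap (c : ZMod n) {m : ℕ} (F : LCLang.Functions m) (x : Fin m → MPrime n) :
    c +ᵥ Structure.funMap F x = Structure.funMap F fun j => c +ᵥ x j := by
  cases F
  · exact vadd_sup c _ _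
  · exact vadd_inf c _ _
  · exact vadd_compl c _
  · rfl
  · rfl

theorem eq_bot_or_eq_top_of_vadd_eq (hn : 3 ≤ n) {x : MPrime n} (h : (1 : ZMod n) +ᵥ x = x) :
    x = ⊥ ∨ x = ⊤ := by
  have : Fact (1 < n) := ⟨by lia⟩
  cases x <;> simp_all [bot_def, top_def]

/-- `M_n'` has an atom for each residue, and two more elements. -/
def equivSum : MPrime n ≃ ZMod n ⊕ Bool where
  toFun
    | zero => .inr false
    | one => .inr true
    | atom i => .inl i
  invFun
    | .inl i => atom i
    | .inr false => zero
    | .inr true => one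
  left_inv x := by cases x <;> rfl
  right_inv x := by rcases x with _ | _ | _ <;> rfl

instance [NeZero n] : Finite (MPrime n) := .of_equiv _ equivSum.symm

theorem card_eq [NeZero n] : Nat.card (MPrime n) = n + 2 := by
  simp [Nat.card_congr equivSum]

/-- This is where `n ≥ 3` is needed: it makes `a_i` and `a_i''` distinct atoms, with join 1 and meet
0. -/
theorem one_add_one_ne_zero (hn : 3 ≤ n) : (1 + 1 : ZMod n) ≠ 0 := by
  intro h
  have : ((2 : ℕ) : ZMod n) = 0 := by rw [← h]; norm_num
  rw [ZMod.natCast_eq_zero_iff] at this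
  exact absurd (Nat.le_of_dvd two_pos this) (by lia)

theorem sup_compl_compl (hn : 3 ≤ n) (x : MPrime n) : x ⊔ xᶜᶜ = if x = ⊥ then ⊥ else ⊤ := by
  cases x <;> simp [sup_def, bot_def, top_def, add_assoc, one_add_one_ne_zero hn]

theorem inf_compl_compl (hn : 3 ≤ n) (x : MPrime n) : x ⊓ xᶜᶜ = if x = ⊤ then ⊤ else ⊥ := by
  cases x <;> simp [inf_def, bot_def, top_def, add_assoc, one_add_one_ne_zero hn]

/-! ### Term functions are the equivariant functions. -/

section TermFunctions

variable {J : Type}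

/-- The algebra of `J`-ary functions on `M_n'` that commute with the rotations. -/
def equivariant (n : ℕ) (J : Type) : LCLang.Substructure ((J → MPrime n) → MPrime n) where
  carrier := {h | ∀ (c : ZMod n) f, h (c +ᵥ f) = c +ᵥ h f}
  fun_mem F x hx := fun c f => by
    refine Eq.trans ?_ (vadd_funMap c F _).symm
    exact congrArg (Structure.funMap F) (funext fun j => hx j c f)

/-- The algebra of `J`-ary term functions of `M_n'`. -/
def termFunctions (n : ℕ) (J : Type) : LCLang.Substructure ((J → MPrime n) → MPrime n) :=
  Substructure.closure LCLang (Set.range fun j f => f j)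

theorem proj_mem_equivariant (j : J) : (fun f => f j) ∈ equivariant n J := fun _ _ => rfl

theorem termFunctions_le_equivariant : termFunctions n J ≤ equivariant n J := by
  rw [termFunctions, Substructure.closure_le]
  rintro _ ⟨j, rfl⟩
  exact proj_mem_equivariant j

theorem proj_mem_termFunctions (j : J) : (fun f => f j) ∈ termFunctions n J :=
  Substructure.subset_closure ⟨j, rfl⟩

variable {S : LCLang.Substructure ((J → MPrime n) → MPrime n)}
  {s t : (J → MPrime n) → MPrime n}

theorem sup_mem (hs : s ∈ S) (ht : t ∈ S) : s ⊔ t ∈ S :=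
  S.fun_mem LCFunc.sup ![s, t] (by intro i; fin_cases i <;> assumption)

theorem inf_mem (hs : s ∈ S) (ht : t ∈ S) : s ⊓ t ∈ S :=
  S.fun_mem LCFunc.inf ![s, t] (by intro i; fin_cases i <;> assumption)

theorem compl_mem (hs : s ∈ S) : sᶜ ∈ S :=
  S.fun_mem LCFunc.compl ![s] (by intro i; fin_cases i; assumption)

theorem bot_mem : ⊥ ∈ S :=
  S.fun_mem LCFunc.zero ![] (fun i => i.elim0)

theorem top_mem : ⊤ ∈ S :=
  S.fun_mem LCFunc.one ![] (fun i => i.elim0)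

/-- Iterated complementation rotates atoms. Nothing is claimed at 0 and 1, which it may swap. -/
theorem exists_mem_rotate_atom [NeZero n] (ht : t ∈ S) (c : ZMod n) :
    ∃ s ∈ S, ∀ f i, t f = atom i → s f = atom (c + i) := by
  obtain ⟨m, rfl⟩ := ZMod.natCast_zmod_surjective c
  induction m with
  | zero => exact ⟨t, ht, by simp⟩
  | succ m ih =>
    obtain ⟨s, hs, h⟩ := ih
    refine ⟨sᶜ, compl_mem hs, fun f i hi => ?_⟩
    rw [Pi.compl_apply, h f i hi, compl_atom]
    push_cast
    ring_nf

theorem exists_mem_apply_eq_iff_ne_bot (hn : 3 ≤ n) (ht : t ∈ S) :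
    ∃ s ∈ S, ∀ f, s f = if t f = ⊥ then ⊥ else ⊤ :=
  ⟨t ⊔ tᶜᶜ, sup_mem ht (compl_mem (compl_mem ht)), fun f => sup_compl_compl hn (t f)⟩

theorem exists_mem_apply_eq_iff_eq_top (hn : 3 ≤ n) (ht : t ∈ S) :
    ∃ s ∈ S, ∀ f, s f = if t f = ⊤ then ⊤ else ⊥ :=
  ⟨t ⊓ tᶜᶜ, inf_mem ht (compl_mem (compl_mem ht)), fun f => inf_compl_compl hn (t f)⟩

/-- Points in different orbits of the rotations are separated by a term function. -/
theorem exists_termFunction_separating [NeZero n] (hn : 3 ≤ n) (f g : J → MPrime n)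
    (hfg : ∀ c : ZMod n, g ≠ c +ᵥ f) : ∃ t ∈ termFunctions n J, t f = ⊤ ∧ t g = ⊥ := by
  have hbt : (⊥ : MPrime n)ᶜ = ⊤ := rfl
  have htb : (⊤ : MPrime n)ᶜ = ⊥ := rfl
  by_cases hbot : ∃ j, ¬ (f j = ⊥ ↔ g j = ⊥)
  · obtain ⟨j, hj⟩ := hbot
    obtain ⟨s, hs, h⟩ := exists_mem_apply_eq_iff_ne_bot hn (proj_mem_termFunctions (n := n) j)
    by_cases hfj : f j = ⊥
    · exact ⟨sᶜ, compl_mem hs, by simp_all⟩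
    · exact ⟨s, hs, by simp_all⟩
  by_cases htop : ∃ j, ¬ (f j = ⊤ ↔ g j = ⊤)
  · obtain ⟨j, hj⟩ := htop
    obtain ⟨s, hs, h⟩ := exists_mem_apply_eq_iff_eq_top hn (proj_mem_termFunctions (n := n) j)
    by_cases hfj : f j = ⊤
    · exact ⟨s, hs, by simp_all⟩
    · exact ⟨sᶜ, compl_mem hs, by simp_all⟩
  -- From here on `f` and `g` have their zeros, ones and atoms at the same coordinates.
  push Not at hbot htop
  have key (j) (h : ∀ i i', ¬ (f j = atom i ∧ g j = atom i')) : g j = f j := by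
    have := hbot j
    have := htop j
    rw [bot_def, top_def] at *
    cases hf : f j <;> cases hg : g j <;> simp_all
  obtain ⟨j₀, i, i', hi, hi'⟩ : ∃ j i i', f j = atom i ∧ g j = atom i' := by
    by_contra! h
    refine hfg 0 (funext fun j => ?_)
    rw [zero_vadd]
    exact key j fun i i' hii => h j i i' hii.1 hii.2
  -- Rotation by `i' - i` is the only one matching `f` with `g` at `j₀`; it must fail at some `j`.
  obtain ⟨j, hj⟩ := Function.ne_iff.1 (hfg (i' - i))
  obtain ⟨p, r, hp, hr⟩ : ∃ p r, f j = atom p ∧ g j = atom r := by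
    by_contra! h
    have hgf := key j fun p r hpr => h p r hpr.1 hpr.2
    apply hj
    rw [Pi.vadd_apply]
    cases hf : f j with
    | zero => simp [hgf, hf]
    | one => simp [hgf, hf]
    | atom p => exact absurd (hgf.trans hf) (h p p hf)
  -- Rotating coordinate `j₀` by `p - i` gives coordinate `j` at `f` but a different atom at `g`, so
  -- the meet with coordinate `j` is nonzero only at `f`.
  obtain ⟨s, hs, h⟩ := exists_mem_rotate_atom (proj_mem_termFunctions (n := n) j₀) (p - i)
  obtain ⟨t, ht, h'⟩ := exists_mem_apply_eq_iff_ne_bot hn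
    (inf_mem (proj_mem_termFunctions (n := n) j) hs)
  have hne : r ≠ p - i + i' := by
    rintro rfl
    apply hj
    rw [Pi.vadd_apply, hp, hr, vadd_atom]
    ring_nf
  refine ⟨t, ht, ?_, ?_⟩
  · rw [h', if_neg]
    simp [h f i hi, hp, bot_def]
  · rw [h', if_pos]
    simp [h g i' hi', hr, inf_def, hne, bot_def]

theorem finset_inf_mem {ι : Type*} (A : Finset ι) (s : ι → (J → MPrime n) → MPrime n)
    (hs : ∀ i ∈ A, s i ∈ S) : A.inf s ∈ S :=
  Finset.inf_induction top_mem (fun _ ha _ hb => inf_mem ha hb) hs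

theorem finset_sup_mem {ι : Type*} (A : Finset ι) (s : ι → (J → MPrime n) → MPrime n)
    (hs : ∀ i ∈ A, s i ∈ S) : A.sup s ∈ S :=
  Finset.sup_induction bot_mem (fun _ ha _ hb => sup_mem ha hb) hs

variable [Finite J]

/-- The characteristic function of an orbit of the rotations is a term function. -/
theorem exists_termFunction_orbit [NeZero n] (hn : 3 ≤ n) (f : J → MPrime n) :
    ∃ t ∈ termFunctions n J, (∀ c : ZMod n, t (c +ᵥ f) = ⊤) ∧
      ∀ g, (∀ c : ZMod n, g ≠ c +ᵥ f) → t g = ⊥ := by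
  classical
  have := Fintype.ofFinite (J → MPrime n)
  choose! s hs hsf hsg using exists_termFunction_separating hn f
  refine ⟨({g | ∀ c : ZMod n, g ≠ c +ᵥ f} : Finset (J → MPrime n)).inf s,
    finset_inf_mem _ _ fun g hg => hs g (by simpa using hg), fun c => ?_, fun g hg => ?_⟩
  · rw [Finset.inf_apply, Finset.inf_eq_top_iff]
    intro g hg
    have hg' : ∀ c : ZMod n, g ≠ c +ᵥ f := by simpa using hg
    rw [termFunctions_le_equivariant (hs g hg'), hsf g hg']
    rfl
  · rw [Finset.inf_apply, eq_bot_iff, ← hsg g hg]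
    exact Finset.inf_le (by simpa using hg)

/-- The term functions of `M_n'` are the functions that commute with the rotations. -/
theorem termFunctions_eq_equivariant [NeZero n] (hn : 3 ≤ n) :
    termFunctions n J = equivariant n J := by
  classical
  have := Fintype.ofFinite (J → MPrime n)
  refine le_antisymm termFunctions_le_equivariant fun h hh => ?_
  -- Interpolation at one point: an atom of `f` can be rotated to any atom, and without atoms `h f`
  -- is a fixed point.
  have hval (f) : ∃ t ∈ termFunctions n J, t f = h f := by
    by_cases hf : ∃ j i, f j = atom i
    · obtain ⟨j, i, hi⟩ := hf
      cases hhf : h f with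
      | zero => exact ⟨⊥, bot_mem, rfl⟩
      | one => exact ⟨⊤, top_mem, rfl⟩
      | atom p =>
        obtain ⟨s, hs, hs'⟩ := exists_mem_rotate_atom (proj_mem_termFunctions (n := n) j) (p - i)
        exact ⟨s, hs, by simp [hs' f i hi]⟩
    · have hfix : (1 : ZMod n) +ᵥ f = f := by
        ext j
        rw [Pi.vadd_apply]
        cases hj : f j with
        | zero => rfl
        | one => rfl
        | atom i => exact absurd ⟨j, i, hj⟩ hf
      have := hh 1 f
      rw [hfix] at this
      obtain h0 | h1 := eq_bot_or_eq_top_of_vadd_eq hn this.symm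
      · exact ⟨⊥, bot_mem, h0.symm⟩
      · exact ⟨⊤, top_mem, h1.symm⟩
  choose s hs hsf using hval
  choose e he hef heg using exists_termFunction_orbit (J := J) hn
  -- At `g`, the joinands with `f` in the orbit of `g` equal `h g` by equivariance; the others
  -- vanish.
  have hsum : h = Finset.univ.sup fun f => e f ⊓ s f := by
    ext1 g
    rw [Finset.sup_apply]
    refine le_antisymm ?_ (Finset.sup_le fun f _ => ?_)
    · refine le_trans ?_ (Finset.le_sup (f := fun f => (e f ⊓ s f) g) (Finset.mem_univ g))
      have := hef g 0
      rw [zero_vadd] at this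
      simp [this, hsf]
    · by_cases hg : ∃ c : ZMod n, g = c +ᵥ f
      · obtain ⟨c, rfl⟩ := hg
        rw [Pi.inf_apply, termFunctions_le_equivariant (hs f), hsf, hh]
        exact inf_le_right
      · push Not at hg
        simp [heg f g hg]
  rw [hsum]
  exact finset_sup_mem _ _ fun f _ => inf_mem (he f) (hs f)

end TermFunctions

end MPrime

/-! ### Orbits of tuples and the product decomposition. -/

namespace MPrime

variable {n : ℕ} {J : Type}

/-- The two-element subalgebra of `M_n'`. -/
def ofBool : Bool → MPrime n
  | false => zero
  | true => one

/-- The retraction onto the two-element subalgebra. -/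
def toBool : MPrime n → Bool
  | one => true
  | _ => false

@[simp] theorem toBool_ofBool (b : Bool) : toBool (ofBool b : MPrime n) = b := by
  cases b <;> rfl

theorem vadd_ofBool_comp (c : ZMod n) (b : J → Bool) :
    c +ᵥ (ofBool ∘ b : J → MPrime n) = ofBool ∘ b := by
  ext j
  rw [Pi.vadd_apply, Function.comp_apply]
  cases b j <;> rfl

/-- The index of an atom. -/
def index : MPrime n → ZMod n
  | atom i => i
  | _ => 0

/-- The coordinates at which a tuple is an atom. -/
def atomSet (f : J → MPrime n) : Set J := {j | ∃ i, f j = atom i}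

theorem atomSet_vadd (c : ZMod n) (f : J → MPrime n) : atomSet (c +ᵥ f) = atomSet f := by
  ext j
  simp only [atomSet, Set.mem_ofPred_eq, Pi.vadd_apply]
  cases f j <;> simp

theorem atomSet_ofBool_comp (b : J → Bool) : atomSet (ofBool ∘ b : J → MPrime n) = ∅ := by
  ext j
  simp only [atomSet, Set.mem_ofPred_eq, Function.comp_apply, Set.mem_empty_iff_false, iff_false]
  cases b j <;> simp [ofBool]

theorem ofBool_comp_toBool_comp {f : J → MPrime n} (hf : ¬ (atomSet f).Nonempty) :
    ofBool ∘ toBool ∘ f = f := by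
  ext j
  rw [Function.comp_apply, Function.comp_apply]
  cases hj : f j with
  | zero => rfl
  | one => rfl
  | atom i => exact absurd ⟨j, i, hj⟩ hf

open Classical in
/-- The index of a chosen atom of a tuple. -/
noncomputable def phase (f : J → MPrime n) : ZMod n :=
  if h : (atomSet f).Nonempty then index (f h.some) else 0

/-- The chosen coordinate depends only on `atomSet f`, which rotations preserve. -/
theorem phase_vadd (c : ZMod n) {f : J → MPrime n} (hf : (atomSet f).Nonempty) :
    phase (c +ᵥ f) = c + phase f := by
  have hcf : (atomSet (c +ᵥ f)).Nonempty := by rwa [atomSet_vadd]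
  rw [phase, phase, dif_pos hf, dif_pos hcf]
  simp only [atomSet_vadd, Pi.vadd_apply]
  obtain ⟨i, hi⟩ := hf.some_mem
  simp [hi, index]

/-- Representatives of the orbits of the rotations on the tuples that contain an atom. -/
abbrev OrbitRep (n : ℕ) (J : Type) : Type :=
  {f : J → MPrime n // (atomSet f).Nonempty ∧ phase f = 0}

/-- The representative of the orbit of a tuple. -/
noncomputable def orbitRep (f : J → MPrime n) (hf : (atomSet f).Nonempty) : OrbitRep n J :=
  ⟨-phase f +ᵥ f, by rwa [atomSet_vadd], by rw [phase_vadd _ hf, neg_add_cancel]⟩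

theorem orbitRep_vadd (c : ZMod n) (f : J → MPrime n) (hf : (atomSet f).Nonempty)
    (hcf : (atomSet (c +ᵥ f)).Nonempty) : orbitRep (c +ᵥ f) hcf = orbitRep f hf := by
  apply Subtype.ext
  simp only [orbitRep, phase_vadd c hf, vadd_vadd]
  congr 1
  ring

theorem orbitRep_coe (r : OrbitRep n J) : orbitRep r.1 r.2.1 = r := by
  apply Subtype.ext
  simp [orbitRep, r.2.2]

open Classical in
/-- A tuple is a rotated orbit representative, or has entries `0` and `1` only. -/
noncomputable def tupleEquiv (n : ℕ) (J : Type) :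
    (J → MPrime n) ≃ (OrbitRep n J × ZMod n) ⊕ (J → Bool) where
  toFun f := if hf : (atomSet f).Nonempty then .inl (orbitRep f hf, phase f) else .inr (toBool ∘ f)
  invFun
    | .inl p => p.2 +ᵥ p.1.1
    | .inr b => ofBool ∘ b
  left_inv f := by
    by_cases hf : (atomSet f).Nonempty
    · simp [dif_pos hf, orbitRep]
    · simp only [dif_neg hf]
      exact ofBool_comp_toBool_comp hf
  right_inv p := by
    obtain ⟨r, c⟩ | b := p
    · have h : (atomSet (c +ᵥ r.1)).Nonempty := by rw [atomSet_vadd]; exact r.2.1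
      simp only [dif_pos h]
      rw [orbitRep_vadd c r.1 r.2.1, orbitRep_coe, phase_vadd c r.2.1, r.2.2, add_zero]
    · have h : ¬ (atomSet (ofBool ∘ b : J → MPrime n)).Nonempty := by simp [atomSet_ofBool_comp]
      simp only [dif_neg h]
      congr 1
      ext j
      simp

theorem card_orbitRep [NeZero n] (k : ℕ) :
    (n + 2) ^ k = Nat.card (OrbitRep n (Fin k)) * n + 2 ^ k := by
  have h := Nat.card_congr (tupleEquiv n (Fin k))
  rw [Nat.card_sum, Nat.card_prod, Nat.card_fun, Nat.card_fun, card_eq] at h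
  simpa using h

/-- `toBool` is not a homomorphism on all of `M_n'`: it sends an atom and its complement both to
`false`. -/
theorem toBool_funMap {m : ℕ} (F : LCLang.Functions m) (x : Fin m → MPrime n)
    (hx : ∀ j, x j = ⊥ ∨ x j = ⊤) :
    toBool (Structure.funMap F x) = Structure.funMap F (toBool ∘ x) := by
  cases F
  · change toBool (x 0 ⊔ x 1) = (toBool (x 0) ⊔ toBool (x 1))
    obtain h | h := hx 0 <;> obtain h' | h' := hx 1 <;> rw [h, h'] <;> rfl
  · change toBool (x 0 ⊓ x 1) = (toBool (x 0) ⊓ toBool (x 1))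
    obtain h | h := hx 0 <;> obtain h' | h' := hx 1 <;> rw [h, h'] <;> rfl
  · change toBool (x 0)ᶜ = (toBool (x 0))ᶜ
    obtain h | h := hx 0 <;> rw [h] <;> rfl
  · rfl
  · rfl

theorem equivariant_apply_ofBool (hn : 3 ≤ n) (h : equivariant n J) (b : J → Bool) :
    h.1 (ofBool ∘ b) = ⊥ ∨ h.1 (ofBool ∘ b) = ⊤ := by
  apply eq_bot_or_eq_top_of_vadd_eq hn
  rw [← h.2, vadd_ofBool_comp]

theorem ofBool_toBool {x : MPrime n} (hx : x = ⊥ ∨ x = ⊤) : ofBool (toBool x) = x := by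
  obtain rfl | rfl := hx <;> rfl

/-- An equivariant function restricts to the orbit representatives and to the `0`-`1`-tuples. -/
def restrictHom (hn : 3 ≤ n) {ι β : Type} (r : ι → OrbitRep n J) (s : β → J → Bool) :
    equivariant n J →[LCLang] ((ι → MPrime n) × (β → Bool)) where
  toFun h := (fun i => h.1 (r i).1, fun i => toBool (h.1 (ofBool ∘ s i)))
  map_fun' F x := Prod.ext rfl <| funext fun i =>
    toBool_funMap F (fun j => (x j).1 (ofBool ∘ s i)) fun j => equivariant_apply_ofBool hn (x j) _
  map_rel' := fun r => nomatch r

theorem restrictHom_bijective (hn : 3 ≤ n) {ι β : Type} (r : ι ≃ OrbitRep n J)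
    (s : β ≃ (J → Bool)) : Function.Bijective (restrictHom hn r s) := by
  classical
  constructor
  · intro h h' heq
    have h₁ (p : OrbitRep n J) : h.1 p.1 = h'.1 p.1 := by
      have := congrFun (congrArg Prod.fst heq) (r.symm p)
      change h.1 (r (r.symm p)).1 = h'.1 (r (r.symm p)).1 at this
      rwa [r.apply_symm_apply] at this
    have h₂ (b : J → Bool) : h.1 (ofBool ∘ b) = h'.1 (ofBool ∘ b) := by
      have := congrFun (congrArg Prod.snd heq) (s.symm b)
      change toBool (h.1 (ofBool ∘ s (s.symm b))) = toBool (h'.1 (ofBool ∘ s (s.symm b))) at this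
      rw [s.apply_symm_apply] at this
      rw [← ofBool_toBool (equivariant_apply_ofBool hn h b), this,
        ofBool_toBool (equivariant_apply_ofBool hn h' b)]
    refine Subtype.ext (funext fun f => ?_)
    obtain ⟨⟨p, c⟩ | b, rfl⟩ := (tupleEquiv n J).symm.surjective f
    · exact (h.2 c p.1).trans ((congrArg (c +ᵥ ·) (h₁ p)).trans (h'.2 c p.1).symm)
    · exact h₂ b
  · rintro ⟨u, v⟩
    -- The only possible equivariant extension: `phase f` is the rotation carrying the
    -- representative to `f`.
    let H : (J → MPrime n) → MPrime n := fun f =>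
      if hf : (atomSet f).Nonempty then phase f +ᵥ u (r.symm (orbitRep f hf))
      else ofBool (v (s.symm (toBool ∘ f)))
    have hH : H ∈ equivariant n J := by
      intro c f
      by_cases hf : (atomSet f).Nonempty
      · have hcf : (atomSet (c +ᵥ f)).Nonempty := by rwa [atomSet_vadd]
        simp only [H, dif_pos hf, dif_pos hcf, orbitRep_vadd c f hf, phase_vadd c hf, vadd_vadd]
      · rw [← ofBool_comp_toBool_comp hf, vadd_ofBool_comp, ofBool_comp_toBool_comp hf]
        simp only [H, dif_neg hf]
        cases v (s.symm (toBool ∘ f)) <;> rfl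
    refine ⟨⟨H, hH⟩, Prod.ext (funext fun i => ?_) (funext fun i => ?_)⟩
    · change H (r i).1 = u i
      simp only [H, dif_pos (r i).2.1, orbitRep_coe, (r i).2.2, zero_vadd, r.symm_apply_apply]
    · change toBool (H (ofBool ∘ s i)) = v i
      have h : ¬ (atomSet (ofBool ∘ s i : J → MPrime n)).Nonempty := by
        simp [atomSet_ofBool_comp]
      have h' : toBool ∘ (ofBool ∘ s i : J → MPrime n) = s i := by
        ext j
        simp
      simp only [H, dif_neg h, h', toBool_ofBool, s.symm_apply_apply]

theorem closure_proj_eq_top [NeZero n] [Finite J] (hn : 3 ≤ n) :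
    Substructure.closure LCLang
      (Set.range fun j => (⟨_, proj_mem_equivariant j⟩ : equivariant n J)) = ⊤ := by
  apply Substructure.map_injective_of_injective (f := (equivariant n J).subtype.toHom)
    (equivariant n J).subtype.injective
  rw [Substructure.map_closure, ← Set.range_comp, ← Hom.range_eq_map, Substructure.range_subtype]
  exact termFunctions_eq_equivariant hn

theorem exists_isFreeInVariety_equiv_equivariant [NeZero n] [Finite J] (hn : 3 ≤ n) :
    ∃ (F : Type u) (_ : LCLang.Structure F) (y : J → F), IsFreeInVariety (MPrime n) F y ∧
      Nonempty (F ≃[LCLang] equivariant n J) :=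
  exists_isFreeInVariety_equiv (closure_proj_eq_top hn)
    (fun a => (piEvalHom _ a).comp (equivariant n J).subtype.toHom) (fun _ _ => rfl)
    fun _ _ h => Subtype.ext (funext h)

/-- Free algebras in the variety of `M_n'` are direct products. -/
theorem nonempty_equiv_of_isFreeInVariety [NeZero n] [Finite J] (hn : 3 ≤ n) {ι β : Type}
    (r : ι ≃ OrbitRep n J) (s : β ≃ (J → Bool)) {F : Type u} [LCLang.Structure F] {x : J → F}
    (hF : IsFreeInVariety (MPrime n) F x) :
    Nonempty (F ≃[LCLang] ((ι → MPrime n) × (β → Bool))) := by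
  obtain ⟨G, _, y, hG, ⟨e⟩⟩ := exists_isFreeInVariety_equiv_equivariant.{u} (J := J) hn
  obtain ⟨e'⟩ := hF.nonempty_equiv hG
  exact ⟨((LCLang.equivOfBijective _ (restrictHom_bijective hn r s)).comp e).comp e'⟩

end MPrime

/-- A power with exponent `1` may be replaced by its base. -/
def LCLang.prodFunUniqueEquiv (ι A B : Type) [Unique ι] [LCLang.Structure A] [LCLang.Structure B] :
    ((ι → A) × B) ≃[LCLang] (A × B) where
  toEquiv := (Equiv.funUnique ι A).prodCongr (Equiv.refl B)
  map_fun' _ _ := rfl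
  map_rel' := fun r => nomatch r

theorem theorem6p6 (k n : ℕ) (hk : 1 ≤ k) (hn : 3 ≤ n) :
    (∃ q : ℕ, (q : ℚ) = (((n : ℚ) + 2) ^ k - 2 ^ k) / n ∧
      (∃ (F : Type u) (_ : LCLang.Structure F) (x : Fin k → F),
        IsFreeInVariety (MPrime n) F x) ∧
      ∀ (F : Type u) [LCLang.Structure F] (x : Fin k → F), IsFreeInVariety (MPrime n) F x →
        Nonempty (F ≃[LCLang] ((Fin q → MPrime n) × (Fin (2 ^ k) → Bool)))) ∧
    (∀ (F : Type u) [LCLang.Structure F] (x : Fin 1 → F), IsFreeInVariety (MPrime n) F x →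
        Nonempty (F ≃[LCLang] (MPrime n × (Fin 2 → Bool)))) := by
  have : NeZero n := ⟨by lia⟩
  have hn0 : (n : ℚ) ≠ 0 := by exact_mod_cast NeZero.ne n
  refine ⟨⟨Nat.card (MPrime.OrbitRep n (Fin k)), ?_, ?_, fun F _ x hF => ?_⟩, fun F _ x hF => ?_⟩
  · rw [eq_div_iff hn0, eq_sub_iff_add_eq]
    exact_mod_cast (MPrime.card_orbitRep k).symm
  · obtain ⟨F, _, x, hF, -⟩ :=
      MPrime.exists_isFreeInVariety_equiv_equivariant.{u} (n := n) (J := Fin k) hn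
    exact ⟨F, _, x, hF⟩
  · exact MPrime.nonempty_equiv_of_isFreeInVariety hn (Finite.equivFin _).symm
      (Fintype.equivOfCardEq (by simp)) hF
  -- For `k = 1` the orbit count reads `n + 2 = q * n + 2`.
  · have hq : Nat.card (MPrime.OrbitRep n (Fin 1)) = 1 := by
      have h := MPrime.card_orbitRep (n := n) 1
      simpa [NeZero.ne n] using h
    obtain ⟨e⟩ := MPrime.nonempty_equiv_of_isFreeInVariety hn
      (Finite.equivFinOfCardEq hq).symm (Fintype.equivOfCardEq (α := Fin 2) (by simp)) hF
    exact ⟨(LCLang.prodFunUniqueEquiv (Fin 1) _ _).comp e⟩
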